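/- Let $n$ and $a$ be integers with $3\le a\le\lfloor n/2\rfloor$. Let $C(n;1,a)$ be the circulant graph with vertices $v_0,\dots,v_{n-1}$ and edges $v_iv_{i+1}$ and $v_iv_{i+a}$ for $0\le i\le n-1$, subscripts being taken modulo $n$. For a connected graph $G$ with at least one edge, let $d(u,v)$ be the distance between $u$ and $v$, let $e(v)$ be the eccentricity of $v$ and let $\operatorname{diam}(G)$ be the diameter of $G$. An *independent broadcast* on $G$ is a function $f:V(G)\to\{0,\dots,\operatorname{diam}(G)\}$ such that $f(v)\le e(v)$ for every vertex $v$, and $d(u,v)>\max\{f(u),f(v)\}$ for every two distinct vertices $u,v$ with $f(u)>0$ and $f(v)>0$. Its *cost* is $\sum_{v\in V(G)}f(v)$. The *broadcast independence number* $\beta_b(G)$ is the maximum cost of an independent broadcast on $G$, and a *$\beta_b$-broadcast* is an independent broadcast of cost $\beta_b(G)$. **Theorem.** If neither of the conditions (i) $n=2a$ and $a$ is even, (ii) $n=2a+1$ is satisfied, then $C(n;1,a)$ admits a $\beta_b$-broadcast $f$ with $f(v)\le 2$ for every vertex $v$. -/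

import Mathlib

namespace Broadcast

variable {V : Type*}

/-- A broadcast on `G`: a map `f : V → {0, …, diam G}` with `f v ≤ e(v)` for every vertex `v`. -/
structure IsBroadcast (G : SimpleGraph V) (f : V → ℕ) : Prop where
  le_diam : ∀ v, f v ≤ G.diam
  le_eccent : ∀ v, (f v : ℕ∞) ≤ G.eccent v

/-- An independent broadcast (on a connected graph): any two distinct broadcast vertices `u`, `v`
are at distance greater than `max (f u) (f v)`. -/
structure IsIndependentBroadcast (G : SimpleGraph V) (f : V → ℕ) : Prop extends
    IsBroadcast G f where
  max_lt_dist : ∀ u v, u ≠ v → 0 < f u → 0 < f v → max (f u) (f v) < G.dist u v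

/-- The cost `σ(f)` of a broadcast; vertices that are not broadcast vertices contribute `0`. -/
def cost [Fintype V] (f : V → ℕ) : ℕ := ∑ v, f v

/-- The broadcast independence number `β_b(G)`: the maximum cost of an independent broadcast.
The maximum is attained, see `isGreatest_broadcastIndependenceNumber`. -/
noncomputable def broadcastIndependenceNumber [Fintype V] (G : SimpleGraph V) : ℕ :=
  sSup {c | ∃ f : V → ℕ, IsIndependentBroadcast G f ∧ cost f = c}

theorem isGreatest_broadcastIndependenceNumber [Fintype V] (G : SimpleGraph V) :
    IsGreatest {c | ∃ f : V → ℕ, IsIndependentBroadcast G f ∧ cost f = c}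
      (broadcastIndependenceNumber G) := by
  have hne : {c | ∃ f : V → ℕ, IsIndependentBroadcast G f ∧ cost f = c}.Nonempty := by
    refine ⟨_, fun _ => 0, ⟨⟨fun v => Nat.zero_le _, fun v => by simp⟩, ?_⟩, rfl⟩
    intro u v _ h
    exact absurd h (lt_irrefl 0)
  have hbdd : BddAbove {c | ∃ f : V → ℕ, IsIndependentBroadcast G f ∧ cost f = c} := by
    refine ⟨∑ _v : V, G.diam, ?_⟩
    rintro c ⟨f, hf, rfl⟩
    exact Finset.sum_le_sum fun v _ => hf.le_diam v
  exact ⟨Nat.sSup_mem hne hbdd, fun c hc => le_csSup hbdd hc⟩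

/-- A `β_b`-broadcast: an independent broadcast of cost `β_b(G)`. -/
def IsOptimalBroadcast [Fintype V] (G : SimpleGraph V) (f : V → ℕ) : Prop :=
  IsIndependentBroadcast G f ∧ cost f = broadcastIndependenceNumber G

/-- `f` is `ℓ`-bounded if all its values are at most `ℓ`. -/
def IsBounded (l : ℕ) (f : V → ℕ) : Prop := ∀ v, f v ≤ l

/-- The circulant graph `C(n; 1, a)`: the vertices are the integers modulo `n`, and two distinct
vertices are adjacent if and only if they differ by `±1` or `±a` modulo `n`. -/
def circulant (n a : ℕ) : SimpleGraph (ZMod n) :=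
  SimpleGraph.circulantGraph {1, (a : ZMod n)}

end Broadcast

/-! Start from an optimal broadcast `f` and remove its values `k ≥ 3` without losing cost: if `f u =
k`, put the value 1 on `k` pairwise nonadjacent vertices of the ball of radius `(k - 1) / 2` about
`u`. Centres are further apart than the larger of their values, so vertices from different balls
stay nonadjacent (`exists_bounded_of_local_replacement`).

The `k` vertices come from `exists_separated_points`. Let `(x, y)` stand for `u + x + y a` and let
`r = (k - 1) / 2`. A checkerboard on two adjacent rows or columns of the ℓ¹-ball of radius `r` has
`2r + 1` points; an even `k` needs one more. Rows serve unless they wrap around badly. Columns then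
serve if `(2r + 1) a < n`, or, after doubling turns the steps `1, a` into `2, -(n - 2a)` for odd
`n`, if `(2r + 1)(n - 2a) < n`. These inequalities hold because `f u ≤ e(u)` provides a vertex at
distance at least `k` from `u`.

For `n = 2a` and `n = 3a`, projection to `ℤ / a` bounds every cost by `a`, and an independent set of
size `a` attains this bound (`a` being odd if `n = 2a`). -/

namespace Broadcast

/-! ### Checkerboard patterns on two rows or two columns -/

/-- The residue of `d` modulo `n` is none of `0`, `±1`, `±a`: integers differing by `d` represent
distinct, nonadjacent vertices of `C(n; 1, a)`. -/
def Separated (n a d : ℤ) : Prop :=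
  ¬ n ∣ d ∧ ¬ n ∣ d - 1 ∧ ¬ n ∣ d + 1 ∧ ¬ n ∣ d - a ∧ ¬ n ∣ d + a

lemma eq_of_dvd_of_lt_two_mul {n t : ℤ} (h : n ∣ t) (h₁ : t < 2 * n) (h₂ : -(2 * n) < t) :
    t = 0 ∨ t = n ∨ t = -n := by
  obtain ⟨c, rfl⟩ := h
  have hn : 0 < n := by omega
  have h₃ : c < 2 := by nlinarith
  have h₄ : -2 < c := by nlinarith
  obtain rfl | rfl | rfl : c = 0 ∨ c = 1 ∨ c = -1 := by omega
  all_goals simp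

/-- Coordinates of a checkerboard on two consecutive rows, with one additional point
`(x₀, -1)` of index `2 * r + 1`. -/
def rowPoint (r x₀ : ℤ) (i : ℕ) : ℤ × ℤ :=
  if (i : ℤ) ≤ 2 * r then ((i : ℤ) - r, (i : ℤ) % 2) else (x₀, -1)

/-- Coordinates of a checkerboard on two consecutive columns, with one additional point
`(-1, r - 1)` of index `2 * r + 1`. -/
def columnPoint (r : ℤ) (i : ℕ) : ℤ × ℤ :=
  if (i : ℤ) ≤ 2 * r then ((i : ℤ) % 2, (i : ℤ) - r) else (-1, r - 1)

lemma rowPoint_norm_le {r x₀ : ℤ} (hx : |x₀| ≤ r - 1) (i : ℕ) :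
    |(rowPoint r x₀ i).1| + |(rowPoint r x₀ i).2| ≤ r := by
  unfold rowPoint
  split_ifs with h
  · rcases Int.emod_two_eq_zero_or_one (i : ℤ) with h₀ | h₀ <;> simp only [h₀] <;>
      simp only [abs_zero, abs_one] <;> have := abs_le.2 (⟨by omega, by omega⟩ :
        -(r - (i : ℤ) % 2) ≤ (i : ℤ) - r ∧ (i : ℤ) - r ≤ r - (i : ℤ) % 2) <;> omega
  · simp only [abs_neg, abs_one]; omega

lemma columnPoint_norm_le {r : ℤ} (hr : 1 ≤ r) (i : ℕ) :
    |(columnPoint r i).1| + |(columnPoint r i).2| ≤ r := by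
  unfold columnPoint
  split_ifs with h
  · rcases Int.emod_two_eq_zero_or_one (i : ℤ) with h₀ | h₀ <;> simp only [h₀] <;>
      simp only [abs_zero, abs_one] <;> have := abs_le.2 (⟨by omega, by omega⟩ :
        -(r - (i : ℤ) % 2) ≤ (i : ℤ) - r ∧ (i : ℤ) - r ≤ r - (i : ℤ) % 2) <;> omega
  · simp only [abs_neg, abs_one]; rw [abs_of_nonneg (by omega)]; omega

/-- The only dangerous wrap-around is a horizontal offset `±(n - 2a)` between the two rows. Such
offsets are odd and at most `2r - 1` in size, so only odd `n` needs the condition `hs`. -/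
lemma rowPoint_separated_of_le {n a r x₀ : ℤ} (hn : 2 * a + 2 ≤ n) (hra : 2 * r < a)
    (hs : n % 2 = 1 → 2 * r ≤ n - 2 * a) {i j : ℕ} (hij : i < j) (hj : (j : ℤ) ≤ 2 * r) :
    Separated n a ((rowPoint r x₀ j).1 - (rowPoint r x₀ i).1 +
      ((rowPoint r x₀ j).2 - (rowPoint r x₀ i).2) * a) := by
  have hi : (i : ℤ) ≤ 2 * r := by omega
  simp only [rowPoint, if_pos hi, if_pos hj]
  refine ⟨fun h => ?_, fun h => ?_, fun h => ?_, fun h => ?_, fun h => ?_⟩ <;>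
    rcases Int.emod_two_eq_zero_or_one (i : ℤ) with h₀ | h₀ <;>
    rcases Int.emod_two_eq_zero_or_one (j : ℤ) with h₁ | h₁ <;>
    rw [h₀, h₁] at h <;>
    have := eq_of_dvd_of_lt_two_mul h (by omega) (by omega) <;> omega

lemma rowPoint_separated_extra {n a r x₀ : ℤ} (hn : 2 * a + 2 ≤ n) (hra : 2 * r < a)
    (hr : 1 ≤ r) (hx : |x₀| ≤ r - 1)
    (hx₂ : (x₀ - r) % 2 = 1)
    (hx₃ : x₀ = r - 1 ∧ ((3 * a - n) % 2 = 0 → 0 ≤ 3 * a - n → 2 * r - 2 < 3 * a - n) ∨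
      x₀ = 3 * a - n - r - 1 ∧ 2 * r + 2 ≤ a)
    {i : ℕ} (hi : (i : ℤ) ≤ 2 * r) :
    Separated n a (x₀ - (rowPoint r x₀ i).1 + (-1 - (rowPoint r x₀ i).2) * a) := by
  rw [abs_le] at hx
  simp only [rowPoint, if_pos hi]
  refine ⟨fun h => ?_, fun h => ?_, fun h => ?_, fun h => ?_, fun h => ?_⟩ <;>
    rcases Int.emod_two_eq_zero_or_one (i : ℤ) with h₀ | h₀ <;>
    rw [h₀] at h <;>
    have := eq_of_dvd_of_lt_two_mul h (by omega) (by omega) <;> omega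

/-! ### Separation of columns by rescaling -/

/-- The step `a` behaves like a step of length `q` up to the scaling `c`, in a cyclic order of
length `n` that is long enough for `2 * r + 1` such steps. -/
lemma not_dvd_of_scaling {n a c q r X Y : ℤ} (hcq : n ∣ c * a - q)
    (hc : c = 1 ∨ c = 2 ∧ q % 2 = 1) (hq : 3 ≤ |q|) (hn : (2 * r + 1) * |q| < n)
    (hXY : X = 0 ∧ Y ≠ 0 ∧ |Y| ≤ 2 * r + 1 ∨ |X| = 1 ∧ |Y| ≤ 2 * r ∨
      |X| = 2 ∧ |Y| ≤ 2 * r - 1 ∨ X = 3 ∧ Y % 2 = 0 ∧ |Y| ≤ 2 * r - 2 ∧ (c = 2 → 0 ≤ q * Y)) :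
    ¬ n ∣ X + Y * a := by
  intro h
  have h₁ : n ∣ c * X + q * Y := by
    have : c * X + q * Y = c * (X + Y * a) - Y * (c * a - q) := by ring
    rw [this]
    exact dvd_sub (h.mul_left _) (hcq.mul_left _)
  have hqY : |q * Y| = |q| * |Y| := abs_mul _ _
  -- Raising `|X|` by one adds at most 2, while lowering the bound on `|Y|` by one saves `|q| ≥ 3`;
  -- hence `(2r + 1)|q| < n` covers every case and the congruence becomes an equation.
  have h₂ : c * X + q * Y = 0 := by
    refine Int.eq_zero_of_abs_lt_dvd h₁ (lt_of_le_of_lt (abs_add_le _ _) ?_)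
    rw [hqY]
    have hX : |c * X| ≤ 2 * |X| := by
      rw [abs_mul]
      have : |c| ≤ 2 := by rcases hc with rfl | ⟨rfl, -⟩ <;> norm_num
      nlinarith [abs_nonneg X]
    rcases hXY with ⟨rfl, -, h⟩ | ⟨hX', h⟩ | ⟨hX', h⟩ | ⟨rfl, -, h, -⟩
    · simp at hX ⊢; nlinarith
    · nlinarith
    · nlinarith
    · norm_num at hX ⊢; nlinarith
  have h₃ : q * Y = -(c * X) := by omega
  rw [h₃, abs_neg, abs_mul] at hqY
  by_cases hY : Y = 0
  · subst hY
    rcases hc with rfl | ⟨rfl, -⟩ <;> simp at hXY h₂ <;> subst h₂ <;> simp at hXY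
  have hY₁ : 1 ≤ |Y| := Int.one_le_abs hY
  rcases hc with rfl | ⟨rfl, hq₂⟩
  · have h₄ : |X| < 3 * 2 := by
      rcases hXY with ⟨rfl, -⟩ | ⟨h, -⟩ | ⟨h, -⟩ | ⟨rfl, -⟩ <;> norm_num <;> omega
    have h₅ : |Y| < 2 := by simp only [abs_one] at hqY; nlinarith
    simp only [abs_one, one_mul] at hqY
    have h₆ : 3 ≤ |X| := by nlinarith
    rcases hXY with ⟨rfl, -⟩ | ⟨h, -⟩ | ⟨h, -⟩ | ⟨rfl, h, -⟩
    · norm_num at h₆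
    · omega
    · omega
    · rcases abs_cases Y with h | h <;> omega
  · rcases hXY with ⟨rfl, -⟩ | ⟨h, -⟩ | ⟨h, -⟩ | ⟨rfl, -, -, h⟩
    · norm_num at hqY; omega
    · rw [h] at hqY; norm_num at hqY; nlinarith
    · rw [h] at hqY; norm_num at hqY
      have : |Y| < 2 := by nlinarith
      have h₆ : |Y| = 1 := by omega
      rw [h₆] at hqY
      rcases abs_cases q with h | h <;> omega
    · have := h rfl
      omega

lemma Separated.neg {n a d : ℤ} (h : Separated n a d) : Separated n a (-d) := by
  obtain ⟨h₀, h₁, h₂, h₃, h₄⟩ := h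
  refine ⟨?_, ?_, ?_, ?_, ?_⟩ <;> rw [← dvd_neg]
  · simpa using h₀
  · simpa [add_comm] using h₂
  · simpa [add_comm, sub_eq_add_neg] using h₁
  · simpa [add_comm] using h₄
  · simpa [add_comm, sub_eq_add_neg] using h₃

lemma separated_of_scaling {n a c q r X Y : ℤ} (hcq : n ∣ c * a - q)
    (hc : c = 1 ∨ c = 2 ∧ q % 2 = 1) (hq : 3 ≤ |q|) (hn : (2 * r + 1) * |q| < n)
    (hXY : X = 0 ∧ Y % 2 = 0 ∧ Y ≠ 0 ∧ |Y| ≤ 2 * r ∨ X = 1 ∧ Y % 2 = 1 ∧ |Y| ≤ 2 * r - 1 ∨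
      X = 2 ∧ Y % 2 = 0 ∧ |Y| ≤ 2 * r - 2 ∧ (c = 2 → 0 ≤ q * Y)) :
    Separated n a (X + Y * a) := by
  have key := fun X Y => not_dvd_of_scaling (X := X) (Y := Y) hcq hc hq hn
  have e₁ : X + Y * a - 1 = (X - 1) + Y * a := by ring
  have e₂ : X + Y * a + 1 = (X + 1) + Y * a := by ring
  have e₃ : X + Y * a - a = X + (Y - 1) * a := by ring
  have e₄ : X + Y * a + a = X + (Y + 1) * a := by ring
  have h₁ : |Y - 1| ≤ |Y| + 1 := by simpa using abs_sub Y 1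
  have h₂ : |Y + 1| ≤ |Y| + 1 := by simpa using abs_add_le Y 1
  unfold Separated
  rw [e₁, e₂, e₃, e₄]
  rcases hXY with ⟨rfl, hY₂, hY, h⟩ | ⟨rfl, hY₂, h⟩ | ⟨rfl, hY₂, h, hs⟩
  · exact ⟨key _ _ (Or.inl ⟨rfl, hY, by omega⟩), key _ _ (Or.inr (Or.inl ⟨by simp, h⟩)),
      key _ _ (Or.inr (Or.inl ⟨by simp, h⟩)), key _ _ (Or.inl ⟨rfl, by omega, by omega⟩),
      key _ _ (Or.inl ⟨rfl, by omega, by omega⟩)⟩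
  · exact ⟨key _ _ (Or.inr (Or.inl ⟨by simp, by omega⟩)),
      key _ _ (Or.inl ⟨by simp, by omega, by omega⟩),
      key _ _ (Or.inr (Or.inr (Or.inl ⟨by simp, h⟩))),
      key _ _ (Or.inr (Or.inl ⟨by simp, by omega⟩)),
      key _ _ (Or.inr (Or.inl ⟨by simp, by omega⟩))⟩
  · exact ⟨key _ _ (Or.inr (Or.inr (Or.inl ⟨by simp, by omega⟩))),
      key _ _ (Or.inr (Or.inl ⟨by simp, by omega⟩)),
      key _ _ (Or.inr (Or.inr (Or.inr ⟨by simp, hY₂, h, hs⟩))),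
      key _ _ (Or.inr (Or.inr (Or.inl ⟨by simp, by omega⟩))),
      key _ _ (Or.inr (Or.inr (Or.inl ⟨by simp, by omega⟩)))⟩

lemma columnPoint_separated_of_le {n a c q r : ℤ} (hcq : n ∣ c * a - q)
    (hc : c = 1 ∨ c = 2 ∧ q % 2 = 1) (hq : 3 ≤ |q|) (hn : (2 * r + 1) * |q| < n)
    {i j : ℕ} (hij : i < j) (hj : (j : ℤ) ≤ 2 * r) :
    Separated n a ((columnPoint r j).1 - (columnPoint r i).1 +
      ((columnPoint r j).2 - (columnPoint r i).2) * a) := by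
  have hi : (i : ℤ) ≤ 2 * r := by omega
  simp only [columnPoint, if_pos hi, if_pos hj]
  have key := fun X Y => separated_of_scaling (X := X) (Y := Y) hcq hc hq hn
  rcases Int.emod_two_eq_zero_or_one (i : ℤ) with h₀ | h₀ <;>
    rcases Int.emod_two_eq_zero_or_one (j : ℤ) with h₁ | h₁ <;> rw [h₀, h₁]
  · exact key _ _ (Or.inl ⟨by ring, by omega, by omega, abs_le.2 ⟨by omega, by omega⟩⟩)
  · exact key _ _ (Or.inr (Or.inl ⟨by ring, by omega, abs_le.2 ⟨by omega, by omega⟩⟩))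
  · rw [← neg_neg (0 - 1 + ((j : ℤ) - r - (i - r)) * a),
      show -(0 - 1 + ((j : ℤ) - r - (i - r)) * a) = 1 + (i - j) * a by ring]
    exact (key _ _ (Or.inr (Or.inl ⟨rfl, by omega, abs_le.2 ⟨by omega, by omega⟩⟩))).neg
  · exact key _ _ (Or.inl ⟨by ring, by omega, by omega, abs_le.2 ⟨by omega, by omega⟩⟩)

/-- Up to sign, the vertical offset is `i - (2r - 1)`, which is nonpositive when the horizontal one
is 2. With `q ≤ 0` this rules out the cancellation `2 * 3 + q * Y = 0`, possible for `q = -3`, at a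
neighbour with horizontal offset 3. -/
lemma columnPoint_separated_extra {n a c q r : ℤ} (hcq : n ∣ c * a - q)
    (hc : c = 1 ∨ c = 2 ∧ q % 2 = 1) (hq : 3 ≤ |q|) (hn : (2 * r + 1) * |q| < n)
    (hr : 1 ≤ r) (hcq₂ : c = 2 → q ≤ 0) {i : ℕ} (hi : (i : ℤ) ≤ 2 * r) :
    Separated n a (-1 - (columnPoint r i).1 + (r - 1 - (columnPoint r i).2) * a) := by
  simp only [columnPoint, if_pos hi]
  have key := fun X Y => separated_of_scaling (X := X) (Y := Y) hcq hc hq hn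
  rw [← neg_neg (-1 - (i : ℤ) % 2 + (r - 1 - ((i : ℤ) - r)) * a),
    show -(-1 - (i : ℤ) % 2 + (r - 1 - ((i : ℤ) - r)) * a) =
      (1 + (i : ℤ) % 2) + (i - (2 * r - 1)) * a by ring]
  refine Separated.neg ?_
  rcases Int.emod_two_eq_zero_or_one (i : ℤ) with h₀ | h₀ <;> rw [h₀]
  · exact key _ _ (Or.inr (Or.inl ⟨rfl, by omega, abs_le.2 ⟨by omega, by omega⟩⟩))
  · exact key _ _ (Or.inr (Or.inr ⟨rfl, by omega, abs_le.2 ⟨by omega, by omega⟩,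
      fun h => mul_nonneg_of_nonpos_of_nonpos (hcq₂ h) (by omega)⟩))

/-! ### Choice of the pattern, given a far point -/

/-- For `n = 2 * a + s` odd, the graph `C(n; 1, a)` is isomorphic to `C(n; 2, s)`; a point far from
the origin forces `n` to be large compared with `s`. -/
lemma mul_lt_of_far_point {n a Z r s : ℤ} (hs : n = 2 * a + s) (hn : n % 2 = 1) (hs₃ : 3 ≤ s)
    (hsr : s ≤ 2 * r - 1) (hZ₀ : 0 ≤ Z) (hZ : 2 * Z ≤ n)
    (hfar : ∀ x y : ℤ, n ∣ x + y * a - Z → 2 * r + 1 ≤ |x| + |y|) :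
    (2 * r + 1) * s < n := by
  obtain ⟨W, σ, hW₀, hW, hσ, hWZ⟩ : ∃ W σ : ℤ, 0 ≤ W ∧ 2 * W ≤ n ∧ (σ = 1 ∨ σ = -1) ∧
      n ∣ σ * W - 2 * Z := by
    by_cases h : 4 * Z ≤ n
    · exact ⟨2 * Z, 1, by omega, by omega, Or.inl rfl, ⟨0, by ring⟩⟩
    · exact ⟨n - 2 * Z, -1, by omega, by omega, Or.inr rfl, ⟨-1, by ring⟩⟩
  -- Since `2a ≡ -s` and 2 is invertible modulo `n`, writing `W = s y + 2 x` amounts to `Z ≡ σ x - σ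
  -- y a`.
  have hfar₂ : ∀ x y : ℤ, W = s * y + 2 * x → 2 * r + 1 ≤ |x| + |y| := by
    intro x y h
    have habs : |σ * x| + |-(σ * y)| = |x| + |y| := by
      rcases hσ with rfl | rfl <;> simp
    rw [← habs]
    refine hfar _ _ ?_
    have hcop : IsCoprime n 2 := ⟨1, -(n / 2), by omega⟩
    refine hcop.dvd_of_dvd_mul_left ?_
    have : 2 * (σ * x + -(σ * y) * a - Z) = (σ * W - 2 * Z) - n * (σ * y) := by
      rw [h, hs]; ring
    rw [this]
    exact dvd_sub hWZ (dvd_mul_right _ _)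
  have hq₀ := Int.mul_ediv_add_emod W s
  have he₀ := Int.emod_nonneg W (show s ≠ 0 by omega)
  have he₁ := Int.emod_lt_of_pos W (show 0 < s by omega)
  have hy : 0 ≤ W / s := Int.ediv_nonneg hW₀ (by omega)
  generalize W / s = y at *
  generalize W % s = e at *
  -- Round the quotient of `W` by `s` up when the remainder is odd, so that what is left is even.
  -- The bound gives `n ≥ 2W ≥ s(4r + 1 - s) ≥ s(2r + 2)`.
  have hy₂ : 4 * r + 1 - s ≤ 2 * y := by
    rcases Int.emod_two_eq_zero_or_one e with h | h
    · have := hfar₂ (e / 2) y (by omega)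
      rw [abs_of_nonneg (by omega), abs_of_nonneg hy] at this
      omega
    · have := hfar₂ ((e - s) / 2) (y + 1) (by rw [mul_add]; omega)
      rw [abs_of_nonpos (by omega), abs_of_nonneg (by omega)] at this
      omega
  nlinarith

/-- If some point of `ℤ / n` is at distance at least `k ≥ 3` from the origin, then the ball of
radius `(k - 1) / 2` contains `k` points that are pairwise at distance at least two. -/
lemma exists_separated_points {n a Z : ℤ} {k : ℕ} (ha : 3 ≤ a) (hn : 2 * a + 2 ≤ n)
    (hn₃ : n ≠ 3 * a) (hk : 3 ≤ k) (hZ₀ : 0 ≤ Z) (hZ : 2 * Z ≤ n)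
    (hfar : ∀ x y : ℤ, n ∣ x + y * a - Z → (k : ℤ) ≤ |x| + |y|) :
    ∃ p : ℕ → ℤ × ℤ, (∀ i, |(p i).1| + |(p i).2| ≤ (((k - 1) / 2 : ℕ) : ℤ)) ∧
      ∀ i j, i < j → j < k → Separated n a ((p j).1 - (p i).1 + ((p j).2 - (p i).2) * a) := by
  obtain ⟨r, hr⟩ : ∃ r : ℤ, r = (((k - 1) / 2 : ℕ) : ℤ) := ⟨_, rfl⟩
  rw [← hr]
  have hr₁ : 1 ≤ r := by omega
  have hkr : (k : ℤ) = 2 * r + 1 ∨ (k : ℤ) = 2 * r + 2 := by omega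
  have hcol : ∀ c q : ℤ, n ∣ c * a - q → (c = 1 ∨ c = 2 ∧ q % 2 = 1 ∧ q ≤ 0) → 3 ≤ |q| →
      (2 * r + 1) * |q| < n →
      ∃ p : ℕ → ℤ × ℤ, (∀ i, |(p i).1| + |(p i).2| ≤ r) ∧
      ∀ i j, i < j → j < k → Separated n a ((p j).1 - (p i).1 + ((p j).2 - (p i).2) * a) := by
    intro c q hcq hc hq hlt
    refine ⟨columnPoint r, columnPoint_norm_le hr₁, fun i j hij hjk => ?_⟩
    by_cases hj : (j : ℤ) ≤ 2 * r
    · exact columnPoint_separated_of_le hcq (by tauto) hq hlt hij hj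
    · have := columnPoint_separated_extra hcq (by tauto) hq hlt hr₁ (by omega)
        (show (i : ℤ) ≤ 2 * r by omega)
      rwa [show columnPoint r j = (-1, r - 1) from if_neg hj]
  have hq₀ := Int.mul_ediv_add_emod Z a
  have he₀ := Int.emod_nonneg Z (show a ≠ 0 by omega)
  have he₁ := Int.emod_lt_of_pos Z (show 0 < a by omega)
  have hQ : 0 ≤ Z / a := Int.ediv_nonneg hZ₀ (by omega)
  have far₁ := hfar (Z % a) (Z / a) ⟨0, by linarith⟩
  have far₂ := hfar (Z % a - a) (Z / a + 1) ⟨0, by linarith⟩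
  rw [abs_of_nonneg he₀, abs_of_nonneg hQ] at far₁
  rw [abs_of_nonpos (by omega), abs_of_nonneg (by omega)] at far₂
  generalize Z / a = Q at *
  generalize Z % a = e at *
  by_cases har : 2 * r < a
  · by_cases hs : n % 2 = 1 → 2 * r ≤ n - 2 * a
    · obtain ⟨x₀, hx, hx₂, hx₃⟩ : ∃ x₀ : ℤ, |x₀| ≤ r - 1 ∧ (x₀ - r) % 2 = 1 ∧
          ((k : ℤ) = 2 * r + 2 → x₀ = r - 1 ∧
            ((3 * a - n) % 2 = 0 → 0 ≤ 3 * a - n → 2 * r - 2 < 3 * a - n) ∨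
          x₀ = 3 * a - n - r - 1 ∧ 2 * r + 2 ≤ a) := by
        by_cases h : (3 * a - n) % 2 = 0 ∧ 0 ≤ 3 * a - n ∧ 3 * a - n ≤ 2 * r - 2
        -- For `x₀ = r - 1` the extra point would be adjacent to the point of odd index `2r - 1 -
        -- (3a - n)`; the shift moves this index to `-1`. As `n ≠ 3a`, still `x₀ ≥ 1 - r`. The
        -- shifted point could also meet index `a - 1`, which `2r + 2 ≤ a` excludes.
        · refine ⟨3 * a - n - r - 1, abs_le.2 ⟨by omega, by omega⟩, by omega,
            fun hk => Or.inr ⟨rfl, ?_⟩⟩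
          have hQ₂ : Q < 2 := by nlinarith
          obtain rfl | rfl : Q = 0 ∨ Q = 1 := by omega
          all_goals omega
        · exact ⟨r - 1, abs_le.2 ⟨by omega, by omega⟩, by omega,
            fun _ => Or.inl ⟨rfl, by omega⟩⟩
      refine ⟨rowPoint r x₀, rowPoint_norm_le hx, fun i j hij hjk => ?_⟩
      by_cases hj : (j : ℤ) ≤ 2 * r
      · exact rowPoint_separated_of_le hn har hs hij hj
      · have := rowPoint_separated_extra hn har hr₁ hx hx₂ (hx₃ (by omega))
          (show (i : ℤ) ≤ 2 * r by omega)
        rwa [show rowPoint r x₀ j = (x₀, -1) from if_neg hj]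
    · refine hcol 2 (-(n - 2 * a)) ⟨1, by ring⟩ (Or.inr ⟨rfl, by omega, by omega⟩) ?_ ?_
      · rw [abs_of_nonpos (by omega)]; omega
      · rw [abs_of_nonpos (by omega), neg_neg]
        exact mul_lt_of_far_point (by ring) (by omega) (by omega) (by omega) hZ₀ hZ
          fun x y h => le_trans (by omega) (hfar x y h)
  · refine hcol 1 a ⟨0, by ring⟩ (Or.inl rfl) ?_ ?_
    · rwa [abs_of_nonneg (by omega)]
    · rw [abs_of_nonneg (by omega)]
      -- Sum of the two far-point bounds. As `a ≤ 2r`, it yields `2Q ≥ 2r + 1`, hence `n ≥ 2aQ + 2e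
      -- ≥ (2r + 1)a + 2e`, strict enough unless `e = 0`.
      have h₁ : 4 * r + 1 - a ≤ 2 * Q := by omega
      rcases eq_or_lt_of_le he₀ with rfl | h
      · have h₂ : a * (2 * r + 1) ≤ a * Q := mul_le_mul_of_nonneg_left (by omega) (by omega)
        have h₃ : 0 < a * (2 * r + 1) := mul_pos (by omega) (by omega)
        linarith
      · nlinarith

/-! ### From integer coordinates to distances in the graph -/

lemma dvd_of_intCast_eq_zero {n : ℕ} {z : ℤ} (h : (z : ZMod n) = 0) : (n : ℤ) ∣ z :=
  (ZMod.intCast_zmod_eq_zero_iff_dvd z n).1 h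

lemma not_adj_of_separated {n a : ℕ} {d : ℤ} {u v : ZMod n} (h : v = u + (d : ZMod n))
    (hd : Separated n a d) : u ≠ v ∧ ¬ (circulant n a).Adj u v := by
  obtain ⟨h₀, h₁, h₂, h₃, h₄⟩ := hd
  subst h
  constructor
  · intro h
    exact h₀ (dvd_of_intCast_eq_zero (by simpa using h))
  · simp only [circulant, SimpleGraph.circulantGraph_adj, Set.mem_insert_iff,
      Set.mem_singleton_iff, sub_add_cancel_left, add_sub_cancel_left]
    rintro ⟨-, (h | h) | (h | h)⟩
    · exact h₂ (dvd_of_intCast_eq_zero (by push_cast; rw [← h]; ring))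
    · exact h₄ (dvd_of_intCast_eq_zero (by push_cast; rw [← h]; ring))
    · exact h₁ (dvd_of_intCast_eq_zero (by push_cast; rw [← h]; ring))
    · exact h₃ (dvd_of_intCast_eq_zero (by push_cast; rw [← h]; ring))

lemma exists_walk_of_adj_add {n : ℕ} {G : SimpleGraph (ZMod n)} {g : ZMod n}
    (h : ∀ u, G.Adj u (u + g)) (u : ZMod n) (i : ℤ) :
    ∃ p : G.Walk u (u + i * g), p.length = i.natAbs := by
  have hnat : ∀ (m : ℕ) (u : ZMod n), ∃ p : G.Walk u (u + m * g), p.length = m := by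
    intro m
    induction m with
    | zero => exact fun u => ⟨SimpleGraph.Walk.nil.copy rfl (by simp), by simp⟩
    | succ m ih =>
      intro u
      obtain ⟨p, hp⟩ := ih u
      refine ⟨(p.concat (h _)).copy rfl (by push_cast; ring), by simp [hp]⟩
  obtain ⟨m, rfl | rfl⟩ := i.eq_nat_or_neg
  · obtain ⟨p, hp⟩ := hnat m u
    exact ⟨p.copy rfl (by simp), by simp [hp]⟩
  · obtain ⟨p, hp⟩ := hnat m (u + ((-(m : ℤ) : ℤ) : ZMod n) * g)
    exact ⟨p.reverse.copy (by push_cast; ring) rfl, by simp [hp]⟩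

variable {n a : ℕ}

lemma circulant_adj_add_one (ha : 3 ≤ a) (han : 2 * a ≤ n) (u : ZMod n) :
    (circulant n a).Adj u (u + 1) := by
  have : Fact (1 < n) := ⟨by omega⟩
  simp [circulant]

lemma circulant_adj_add (ha : 3 ≤ a) (han : 2 * a ≤ n) (u : ZMod n) :
    (circulant n a).Adj u (u + a) := by
  have : (a : ZMod n) ≠ 0 := by
    rw [Ne, ZMod.natCast_eq_zero_iff]
    exact Nat.not_dvd_of_pos_of_lt (by omega) (by omega)
  simp [circulant, this]

lemma exists_circulant_walk (ha : 3 ≤ a) (han : 2 * a ≤ n) (u : ZMod n) (x y : ℤ) :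
    ∃ p : (circulant n a).Walk u (u + x + y * a), p.length = x.natAbs + y.natAbs := by
  obtain ⟨p, hp⟩ := exists_walk_of_adj_add (circulant_adj_add_one ha han) u x
  obtain ⟨q, hq⟩ := exists_walk_of_adj_add (circulant_adj_add ha han) (u + x * 1) y
  exact ⟨(p.append q).copy rfl (by simp), by simp [hp, hq]⟩

lemma circulant_dist_le (ha : 3 ≤ a) (han : 2 * a ≤ n) {u v : ZMod n} {x y : ℤ}
    (h : v = u + x + y * a) : (circulant n a).dist u v ≤ x.natAbs + y.natAbs := by
  obtain ⟨p, hp⟩ := exists_circulant_walk ha han u x y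
  subst h
  exact hp ▸ SimpleGraph.dist_le p

lemma circulant_connected [NeZero n] (ha : 3 ≤ a) (han : 2 * a ≤ n) :
    (circulant n a).Connected := by
  refine ⟨fun u v => ?_⟩
  obtain ⟨p, -⟩ := exists_circulant_walk ha han u (v - u).val 0
  exact ⟨p.copy rfl (by simp)⟩

lemma one_lt_dist {V : Type*} {G : SimpleGraph V} (hG : G.Connected) {u v : V} (h : u ≠ v)
    (h' : ¬ G.Adj u v) : 1 < G.dist u v := by
  have h₀ := hG.pos_dist_of_ne h
  have h₁ : G.dist u v ≠ 1 := fun h₂ => h' (SimpleGraph.dist_eq_one_iff_adj.1 h₂)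
  omega

/-- For every vertex `u`, a broadcast `f` on a connected graph leaves some vertex at distance
at least `f u` from `u`. -/
lemma exists_le_dist {V : Type*} [Finite V] {G : SimpleGraph V} (hG : G.Connected) {f : V → ℕ}
    (hf : IsBroadcast G f) (u : V) : ∃ v, f u ≤ G.dist u v := by
  obtain ⟨v, hv⟩ := G.exists_edist_eq_eccent_of_finite u
  refine ⟨v, ?_⟩
  have := hf.le_eccent u
  rw [← hv, ← (hG u v).coe_dist_eq_edist] at this
  exact_mod_cast this

lemma isIndependentBroadcast_of_le_two {V : Type*} [Finite V] [Nontrivial V] {G : SimpleGraph V}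
    (hG : G.Connected) {f : V → ℕ}
    (hf : ∀ u v, u ≠ v → 0 < f u → 0 < f v → max (f u) (f v) < G.dist u v)
    (h₂ : ∀ v, 1 < f v → f v ≤ G.diam ∧ (f v : ℕ∞) ≤ G.eccent v) :
    IsIndependentBroadcast G f := by
  refine ⟨⟨fun v => ?_, fun v => ?_⟩, hf⟩
  · by_cases h : 1 < f v
    · exact (h₂ v h).1
    · have := SimpleGraph.connected_iff_diam_ne_zero.1 hG
      omega
  · by_cases h : 1 < f v
    · exact (h₂ v h).2
    · refine le_trans (b := 1) (by exact_mod_cast (by omega : f v ≤ 1)) ?_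
      exact Order.one_le_iff_pos.2 ((SimpleGraph.eccent_pos_iff v).2 inferInstance)

lemma exists_finset_of_separated [NeZero n] (ha : 3 ≤ a) (han : 2 * a ≤ n) (u : ZMod n) {k : ℕ}
    {p : ℕ → ℤ × ℤ}
    (hp : ∀ i j, i < j → j < k → Separated n a ((p j).1 - (p i).1 + ((p j).2 - (p i).2) * a)) :
    ∃ S : Finset (ZMod n), S.card = k ∧ (∀ x ∈ S, ∃ i, x = u + (p i).1 + (p i).2 * a) ∧
      ∀ x ∈ S, ∀ y ∈ S, x ≠ y → 1 < (circulant n a).dist x y := by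
  let F : ℕ → ZMod n := fun i => u + (p i).1 + (p i).2 * a
  have hF : ∀ i j, i < j → j < k → F i ≠ F j ∧ ¬ (circulant n a).Adj (F i) (F j) :=
    fun i j hij hj => not_adj_of_separated (by simp only [F]; push_cast; ring) (hp i j hij hj)
  have hF₂ : ∀ i < k, ∀ j < k, i ≠ j → F i ≠ F j ∧ 1 < (circulant n a).dist (F i) (F j) := by
    intro i hi j hj hij
    have hG := circulant_connected ha han
    rcases lt_or_gt_of_ne hij with h | h
    · obtain ⟨h₁, h₂⟩ := hF i j h hj
      exact ⟨h₁, one_lt_dist hG h₁ h₂⟩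
    · obtain ⟨h₁, h₂⟩ := hF j i h hi
      exact ⟨h₁.symm, SimpleGraph.dist_comm (G := circulant n a) ▸ one_lt_dist hG h₁ h₂⟩
  refine ⟨(Finset.range k).image F, ?_, ?_, ?_⟩
  · rw [Finset.card_image_of_injOn, Finset.card_range]
    intro i hi j hj hij
    by_contra h
    exact (hF₂ i (by simpa using hi) j (by simpa using hj) h).1 hij
  · simp only [Finset.mem_image, Finset.mem_range]
    rintro _ ⟨i, -, rfl⟩
    exact ⟨i, rfl⟩
  · simp only [Finset.mem_image, Finset.mem_range]
    rintro _ ⟨i, hi, rfl⟩ _ ⟨j, hj, rfl⟩ hij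
    exact (hF₂ i hi j hj (by rintro rfl; exact hij rfl)).2

/-- The local replacement: `k` pairwise nonadjacent vertices in a ball of radius `(k - 1) / 2`. -/
lemma exists_independent_subset_ball [NeZero n] (ha : 3 ≤ a) (hn : 2 * a + 2 ≤ n)
    (hn₃ : n ≠ 3 * a) {k : ℕ} (hk : 3 ≤ k) {u v : ZMod n}
    (huv : k ≤ (circulant n a).dist u v) :
    ∃ S : Finset (ZMod n), S.card = k ∧ (∀ x ∈ S, (circulant n a).dist u x ≤ (k - 1) / 2) ∧
      ∀ x ∈ S, ∀ y ∈ S, x ≠ y → 1 < (circulant n a).dist x y := by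
  have han : 2 * a ≤ n := by omega
  obtain ⟨σ, Z, hσ, hZ₀, hZ, hv⟩ : ∃ σ Z : ℤ, (σ = 1 ∨ σ = -1) ∧ 0 ≤ Z ∧ 2 * Z ≤ n ∧
      v = u + (σ * Z : ℤ) := by
    have hlt := ZMod.val_lt (v - u)
    have hval : (((v - u).val : ℤ) : ZMod n) = v - u := by simp
    by_cases h : 2 * (v - u).val ≤ n
    · exact ⟨1, (v - u).val, Or.inl rfl, by omega, by omega, by rw [one_mul, hval]; ring⟩
    · refine ⟨-1, n - (v - u).val, Or.inr rfl, by omega, by omega, ?_⟩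
      push_cast
      simp
  have hσ₂ : σ * σ = 1 := by rcases hσ with rfl | rfl <;> rfl
  have hfar : ∀ x y : ℤ, (n : ℤ) ∣ x + y * a - Z → (k : ℤ) ≤ |x| + |y| := by
    intro x y h
    have h₁ : ((σ * (x + y * a - Z) : ℤ) : ZMod n) = 0 :=
      (ZMod.intCast_zmod_eq_zero_iff_dvd _ n).2 (h.mul_left _)
    have h₂ := circulant_dist_le ha han (u := u) (v := v) (x := σ * x) (y := σ * y) (by
      rw [hv]; push_cast at h₁ ⊢; linear_combination -h₁)
    have h₃ : ((σ * x).natAbs : ℤ) = |x| := by rcases hσ with rfl | rfl <;> simp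
    have h₄ : ((σ * y).natAbs : ℤ) = |y| := by rcases hσ with rfl | rfl <;> simp
    omega
  obtain ⟨p, hp, hsep⟩ := exists_separated_points (n := n) (a := a) (by omega) (by omega)
    (by omega) hk hZ₀ hZ hfar
  obtain ⟨S, hS, hmem, hind⟩ := exists_finset_of_separated ha han u hsep
  refine ⟨S, hS, fun x hx => ?_, hind⟩
  obtain ⟨i, hi⟩ := hmem x hx
  have h₁ := circulant_dist_le ha han hi
  have h₂ := hp i
  rw [Int.abs_eq_natAbs, Int.abs_eq_natAbs] at h₂
  omega

/-! ### Local replacement of large values -/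

/-- If every vertex of a connected graph that carries a value `k ≥ 3` has `k` pairwise nonadjacent
vertices within distance `(k - 1) / 2`, then the values at least `3` can be eliminated. -/
lemma exists_bounded_of_local_replacement {V : Type*} [Fintype V] [Nontrivial V]
    {G : SimpleGraph V} (hG : G.Connected) {f : V → ℕ} (hf : IsIndependentBroadcast G f)
    (hloc : ∀ u, 3 ≤ f u → ∃ S : Finset V, S.card = f u ∧
      (∀ x ∈ S, G.dist u x ≤ (f u - 1) / 2) ∧ ∀ x ∈ S, ∀ y ∈ S, x ≠ y → 1 < G.dist x y) :
    ∃ g : V → ℕ, IsIndependentBroadcast G g ∧ IsBounded 2 g ∧ cost f ≤ cost g := by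
  classical
  have hS : ∀ u, ∃ (S : Finset V) (w : ℕ), f u ≤ S.card * w ∧ w ≤ 2 ∧ w ≤ f u ∧
      (w = 2 → S = {u} ∧ f u = 2) ∧ (∀ x ∈ S, G.dist u x ≤ (f u - 1) / 2) ∧
      ∀ x ∈ S, ∀ y ∈ S, x ≠ y → w < G.dist x y := by
    intro u
    by_cases hu : 3 ≤ f u
    · obtain ⟨S, h₁, h₂, h₃⟩ := hloc u hu
      exact ⟨S, 1, by omega, by omega, by omega, by omega, h₂, h₃⟩
    · refine ⟨{u}, f u, by simp, by omega, le_rfl, fun h => ⟨rfl, h⟩, by simp, ?_⟩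
      simp only [Finset.mem_singleton]
      rintro x rfl y rfl h
      exact absurd rfl h
  choose S w hcard hw₂ hwf hw hrad hind using hS
  have hcross : ∀ u v, u ≠ v → 0 < w u → 0 < w v → ∀ x ∈ S u, ∀ y ∈ S v,
      max (w u) (w v) < G.dist x y := by
    intro u v huv hu hv x hx y hy
    have h₁ := hf.max_lt_dist u v huv (hu.trans_le (hwf u)) (hv.trans_le (hwf v))
    have h₂ := hrad u x hx
    have h₃ := hrad v y hy
    have h₄ : G.dist u v ≤ G.dist u x + (G.dist x y + G.dist y v) :=
      hG.dist_triangle.trans (Nat.add_le_add_left hG.dist_triangle _)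
    rw [SimpleGraph.dist_comm (u := y)] at h₄
    -- With `M = max (f u) (f v)`, the distance is at least `M + 1 - 2⌊(M - 1)/2⌋ ≥ 2`. A vertex of
    -- weight 2 has radius 0, which improves this to `M + 1 - ⌊(M - 1)/2⌋ ≥ 3`.
    have h₅ := hw₂ u
    have h₆ := hw₂ v
    have h₇ := hwf u
    have h₈ := hwf v
    have h₉ : w u = 2 → f u = 2 := fun h => (hw u h).2
    have h₀ : w v = 2 → f v = 2 := fun h => (hw v h).2
    omega
  let g : V → ℕ := fun x => ∑ u, if x ∈ S u then w u else 0
  have hg : ∀ x, 0 < g x → ∃ u, x ∈ S u ∧ g x = w u := by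
    intro x hx
    obtain ⟨u, -, hu⟩ := Finset.exists_ne_zero_of_sum_ne_zero hx.ne'
    have hxu : x ∈ S u := by by_contra h; simp [h] at hu
    have hwu : 0 < w u := by rw [if_pos hxu] at hu; omega
    refine ⟨u, hxu, ?_⟩
    have : g x = if x ∈ S u then w u else 0 := by
      refine Finset.sum_eq_single u (fun v _ hv => ?_) (by simp)
      by_contra h
      have hxv : x ∈ S v := by by_contra h'; simp [h'] at h
      rw [if_pos hxv] at h
      simpa using hcross u v hv.symm hwu (by omega) x hxu x hxv
    rw [this, if_pos hxu]
  refine ⟨g, isIndependentBroadcast_of_le_two hG ?_ ?_, ?_, ?_⟩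
  · intro x y hxy hx hy
    obtain ⟨u, hxu, hgx⟩ := hg x hx
    obtain ⟨v, hyv, hgy⟩ := hg y hy
    rw [hgx, hgy]
    by_cases huv : u = v
    · subst huv
      rw [max_self]
      exact hind u x hxu y hyv hxy
    · exact hcross u v huv (by omega) (by omega) x hxu y hyv
  · intro x hx
    obtain ⟨u, hxu, hgx⟩ := hg x (by omega)
    have h₁ := hw₂ u
    obtain ⟨h₂, h₃⟩ := hw u (by omega)
    rw [h₂, Finset.mem_singleton] at hxu
    subst hxu
    rw [show g x = f x by omega]
    exact ⟨hf.le_diam x, hf.le_eccent x⟩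
  · intro x
    by_cases hx : 0 < g x
    · obtain ⟨u, -, hgx⟩ := hg x hx
      exact hgx ▸ hw₂ u
    · omega
  · unfold cost
    simp only [g]
    rw [Finset.sum_comm]
    refine Finset.sum_le_sum fun u _ => (hcard u).trans_eq ?_
    simp [Finset.sum_ite_mem]

/-! ### The cases `n = 2a` and `n = 3a` -/

/-- When `n` is `2 * a` or `3 * a`, the fibres of the projection onto `ℤ / a` are cliques. -/
lemma circulant_dist_le_of_castHom_eq [NeZero n] (ha : 3 ≤ a) (hn : n = 2 * a ∨ n = 3 * a)
    (hdvd : a ∣ n) {u v : ZMod n} {j : ℤ}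
    (h : ZMod.castHom hdvd (ZMod a) v = ZMod.castHom hdvd (ZMod a) u + j) :
    (circulant n a).dist u v ≤ j.natAbs + 1 := by
  have han : 2 * a ≤ n := by omega
  obtain ⟨z, hz⟩ : ∃ z : ZMod n, z = v - u - j := ⟨_, rfl⟩
  have hz₀ : ZMod.castHom hdvd (ZMod a) z = 0 := by
    rw [hz, map_sub, map_sub, h, map_intCast]; ring
  rw [← ZMod.natCast_zmod_val z, map_natCast, ZMod.natCast_eq_zero_iff] at hz₀
  obtain ⟨t, ht⟩ := hz₀
  have hlt := ZMod.val_lt z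
  have hz₁ : z = t * a := by rw [← ZMod.natCast_zmod_val z, ht]; push_cast; ring
  have ht₃ : t < 3 := by
    by_contra h
    have : a * 3 ≤ a * t := Nat.mul_le_mul_left _ (by omega)
    omega
  have hv : v = u + j + t * a := by rw [← hz₁, hz]; ring
  by_cases ht₂ : t = 2
  · subst ht₂
    have h₃ : (3 : ZMod n) * a = 0 := by
      have h := (ZMod.natCast_eq_zero_iff (3 * a) n).2 ⟨1, by omega⟩
      exact_mod_cast h
    refine (circulant_dist_le ha han (x := j) (y := -1) ?_).trans (by simp)
    rw [hv]; push_cast; linear_combination h₃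
  · exact (circulant_dist_le ha han (x := j) (y := t) (by simpa using hv)).trans (by omega)

/-- Each `u` claims the `f u` consecutive residues modulo `a` starting at its image. An overlap
would put two broadcast vertices at distance at most the larger of their values, so all claims are
disjoint. -/
lemma cost_le_of_eq_mul [NeZero n] (ha : 3 ≤ a) (hn : n = 2 * a ∨ n = 3 * a)
    {f : ZMod n → ℕ} (hf : IsIndependentBroadcast (circulant n a) f) : cost f ≤ a := by
  have han : 2 * a ≤ n := by omega
  have hdvd : a ∣ n := by rcases hn with rfl | rfl <;> simp
  have : NeZero a := ⟨by omega⟩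
  have hle : ∀ u, f u ≤ a := by
    intro u
    obtain ⟨v, hv⟩ := exists_le_dist (circulant_connected ha han) hf.toIsBroadcast u
    have h₁ := circulant_dist_le_of_castHom_eq ha hn hdvd (u := u) (v := v)
      (j := (ZMod.castHom hdvd (ZMod a) (v - u)).valMinAbs) (by
        rw [ZMod.coe_valMinAbs, map_sub]; ring)
    have h₂ := ZMod.natAbs_valMinAbs_le (ZMod.castHom hdvd (ZMod a) (v - u))
    omega
  let φ : (Σ u : ZMod n, Fin (f u)) → ZMod a := fun p => ZMod.castHom hdvd (ZMod a) p.1 + p.2.val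
  have hφ : Function.Injective φ := by
    rintro ⟨u, i⟩ ⟨v, j⟩ h
    simp only [φ] at h
    have huv : u = v := by
      by_contra huv
      have h₁ := hf.max_lt_dist u v huv (by have := i.2; omega) (by have := j.2; omega)
      have h₂ := circulant_dist_le_of_castHom_eq ha hn hdvd (u := u) (v := v)
        (j := (i.val : ℤ) - j.val) (by push_cast; linear_combination -h)
      have := i.2
      have := j.2
      omega
    subst huv
    have hij := add_left_cancel h
    rw [ZMod.natCast_eq_natCast_iff'] at hij
    have := hle u
    rw [Nat.mod_eq_of_lt (by omega), Nat.mod_eq_of_lt (by omega)] at hij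
    rw [Fin.ext hij]
  have := Fintype.card_le_of_injective φ hφ
  simpa [cost, ZMod.card] using this

lemma exists_bounded_of_eq_mul [NeZero n] (ha : 3 ≤ a)
    (hn : n = 2 * a ∧ ¬ Even a ∨ n = 3 * a) :
    ∃ g : ZMod n → ℕ, IsIndependentBroadcast (circulant n a) g ∧ IsBounded 2 g ∧ a ≤ cost g := by
  classical
  have han : 2 * a ≤ n := by omega
  have : Fact (1 < n) := ⟨by omega⟩
  rw [Nat.not_even_iff] at hn
  -- A two-row checkerboard of length `a`. For `n = 2a` its last point must lie in the row of its
  -- first, as `2a - 1` is adjacent to `0`; this is where `a` odd enters.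
  obtain ⟨S, hS, -, hind⟩ := exists_finset_of_separated ha han (0 : ZMod n) (k := a)
    (p := fun i => ((i : ℤ), (i : ℤ) % 2)) (fun i j hij hj => by
      refine ⟨fun h => ?_, fun h => ?_, fun h => ?_, fun h => ?_, fun h => ?_⟩ <;>
        rcases Int.emod_two_eq_zero_or_one (i : ℤ) with h₀ | h₀ <;>
        rcases Int.emod_two_eq_zero_or_one (j : ℤ) with h₁ | h₁ <;>
        simp only [h₀, h₁] at h <;>
        have := eq_of_dvd_of_lt_two_mul h (by omega) (by omega) <;> omega)
  refine ⟨fun x => if x ∈ S then 1 else 0,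
    isIndependentBroadcast_of_le_two (circulant_connected ha han) ?_ ?_, ?_, ?_⟩
  · intro x y hxy hx hy
    have hxS : x ∈ S := by by_contra h; simp [h] at hx
    have hyS : y ∈ S := by by_contra h; simp [h] at hy
    simpa [hxS, hyS] using hind x hxS y hyS hxy
  · intro x hx
    split_ifs at hx <;> omega
  · intro x
    dsimp only
    split_ifs <;> omega
  · simp [cost, hS]

end Broadcast

theorem mainTheorem1 (n a : ℕ) [NeZero n] (ha : 3 ≤ a) (han : a ≤ n / 2)
    (h₁ : ¬ (n = 2 * a ∧ Even a)) (h₂ : n ≠ 2 * a + 1) :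
    ∃ f : ZMod n → ℕ, Broadcast.IsOptimalBroadcast (Broadcast.circulant n a) f ∧
      Broadcast.IsBounded 2 f := by
  have : Fact (1 < n) := ⟨by omega⟩
  obtain ⟨⟨f, hf, hcost⟩, hmax⟩ :=
    Broadcast.isGreatest_broadcastIndependenceNumber (Broadcast.circulant n a)
  obtain ⟨g, hg, hg₂, hfg⟩ : ∃ g : ZMod n → ℕ,
      Broadcast.IsIndependentBroadcast (Broadcast.circulant n a) g ∧ Broadcast.IsBounded 2 g ∧
        Broadcast.cost f ≤ Broadcast.cost g := by
    by_cases hn : n = 2 * a ∨ n = 3 * a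
    · obtain ⟨g, hg, hg₂, hag⟩ := Broadcast.exists_bounded_of_eq_mul ha (by tauto)
      exact ⟨g, hg, hg₂, (Broadcast.cost_le_of_eq_mul ha hn hf).trans hag⟩
    · have hconn := Broadcast.circulant_connected (n := n) ha (by omega)
      refine Broadcast.exists_bounded_of_local_replacement hconn hf fun u hu => ?_
      obtain ⟨v, hv⟩ := Broadcast.exists_le_dist hconn hf.toIsBroadcast u
      exact Broadcast.exists_independent_subset_ball ha (by omega) (by omega) hu hv
  exact ⟨g, ⟨hg, le_antisymm (hmax ⟨g, hg, rfl⟩) (hcost ▸ hfg)⟩, hg₂⟩
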